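/- Let $M$ be a compact metric space with Borel $\sigma$-algebra $\mathcal B$, let $\tau:M\to M$ be continuous and uniquely ergodic, i.e. $\tau$ has exactly one invariant Borel probability measure, and let $\mu$ be this measure. Let $(\Omega,\mathcal F,P)$ be a probability space and let $(\theta_k)_{k\in\mathbb Z^d}$ be a $d$-parameter group of measure-preserving transformations of it, i.e. each $\theta_k$ is measurable and preserves $P$, $\theta_0=\mathrm{Id}$ and $\theta_k\circ\theta_l=\theta_{k+l}$ for all $k,l\in\mathbb Z^d$. Suppose that $P$ is strongly mixing with respect to $(\theta_k)_{k\in\mathbb Z^d}$, i.e. $P(A\cap\theta_k^{-1}B)\to P(A)P(B)$ as $\|k\|\to\infty$ for all $A,B\in\mathcal F$, where $\|\cdot\|$ is the maximum norm on $\mathbb Z^d$. Let $\kappa:M\to\mathbb Z^d$ be $\mathcal B$-measurable, put $\kappa_n=\sum_{i=0}^{n-1}\kappa\circ\tau^i$ for $n\ge 0$, and assume that for every $m\in\mathbb N$ $$\lim_{n\to\infty}\frac1{n^2}\,\sup_{t\in M}\bigl|\{(i,j): 1\le i,j\le n,\ \|\kappa_i(t)-\kappa_j(t)\|\le m\}\bigr|=0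 .$$ Let $1\le p<\infty$, and let $F:M\times\Omega\to\mathbb R$ be $\mathcal B\otimes\mathcal F$-measurable such that $\sup_{t\in M}|F(t,\cdot)|\in L^p(\Omega,\mathcal F,P)$ and $F(\cdot,\omega)$ is continuous on $M$ for $P$-almost every $\omega$. Then $F$ is integrable with respect to $\mu\otimes P$, for all $n\ge 1$ and $t\in M$ the function $\frac1n\sum_{i=0}^{n-1}F(\tau^i(t),\theta_{\kappa_i(t)}\,\cdot\,)$ is in $L^p(P)$, and $$\lim_{n\to\infty}\ \sup_{t\in M}\ \Bigl\|\frac1n\sum_{i=0}^{n-1}F\bigl(\tau^i(t),\theta_{\kappa_i(t)}\,\cdot\,\bigr)-\int_{M\times\Omega}F\,d(\mu\otimes P)\Bigr\|_{L^p(P)}=0 .$$ -/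

import Mathlib

open MeasureTheory Filter Topology

/-- A `d`-parameter group `(θ_k)`, `k ∈ ℤ^d`, of measure-preserving transformations of `(Ω, P)`. -/
structure IsMeasurePreservingGroup {Ω : Type*} [MeasurableSpace Ω] {d : ℕ}
    (θ : (Fin d → ℤ) → Ω → Ω) (P : Measure Ω) : Prop where
  measurePreserving : ∀ k, MeasurePreserving (θ k) P P
  zero : θ 0 = id
  comp : ∀ k l, θ k ∘ θ l = θ (k + l)

/-- `P` is strongly mixing with respect to `(θ_k)`: for all measurable `A`, `B`,
`P (A ∩ θ_k⁻¹ B) → P A * P B` as `‖k‖ → ∞` (maximum norm on `ℤ^d`). -/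
def IsStronglyMixing {Ω : Type*} [MeasurableSpace Ω] {d : ℕ}
    (θ : (Fin d → ℤ) → Ω → Ω) (P : Measure Ω) : Prop :=
  ∀ A B : Set Ω, MeasurableSet A → MeasurableSet B →
    Tendsto (fun k : Fin d → ℤ => P.real (A ∩ θ k ⁻¹' B))
      (comap (fun k : Fin d → ℤ => ‖k‖) atTop) (𝓝 (P.real A * P.real B))

/-- `τ` has exactly one invariant Borel probability measure. -/
def IsUniquelyErgodic {M : Type*} [MeasurableSpace M] (τ : M → M) : Prop :=
  ∃! ν : Measure M, IsProbabilityMeasure ν ∧ MeasurePreserving τ ν ν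

open Classical in
/-- The number of pairs `(i, j)` with `1 ≤ i, j ≤ n` and `‖κ_i(t) - κ_j(t)‖ ≤ m`, where
`κ_i = ∑_{l < i} κ ∘ τ^l` is the ergodic sum and `‖·‖` is the maximum norm on `ℤ^d`. -/
noncomputable def closePairCount {M : Type*} {d : ℕ} (τ : M → M) (κ : M → Fin d → ℤ)
    (m n : ℕ) (t : M) : ℕ :=
  ((Finset.Icc 1 n ×ˢ Finset.Icc 1 n).filter fun q : ℕ × ℕ =>
    ‖birkhoffSum τ κ q.1 t - birkhoffSum τ κ q.2 t‖ ≤ (m : ℝ)).card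

/-- The uniform growth condition on the ergodic sums of `κ` along `τ`. The counts are at most
`n ^ 2`, so the supremum is that of a bounded family. -/
def PairCountCondition {M : Type*} {d : ℕ} (τ : M → M) (κ : M → Fin d → ℤ) : Prop :=
  ∀ m : ℕ, Tendsto (fun n : ℕ => 1 / (n : ℝ) ^ 2 * ⨆ t : M, (closePairCount τ κ m n t : ℝ))
    atTop (𝓝 0)

/-- The averages `(1/n) ∑_{i < n} F (τ^i t, θ_{κ_i(t)} ω)` of `F` along the orbit of the skew
product `S (t, ω) = (τ t, θ_{κ(t)} ω)`. -/
noncomputable def skewAverage {M Ω : Type*} {d : ℕ} (τ : M → M) (κ : M → Fin d → ℤ)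
    (θ : (Fin d → ℤ) → Ω → Ω) (F : M × Ω → ℝ) (n : ℕ) (t : M) (ω : Ω) : ℝ :=
  1 / (n : ℝ) * ∑ i ∈ Finset.range n, F (τ^[i] t, θ (birkhoffSum τ κ i t) ω)

/-! By dominated convergence `t ↦ F (t, ·)` is continuous into `L^p`, so on the compact space `M`
finitely many simple functions approximate all its values
(`exists_finset_simpleFunc_eLpNorm_sub_le`). For the centred simple functions, mixing makes
correlations small beyond some displacement `m`, and the pair count condition leaves only `o(n ^ 2)`
index pairs within `m`, uniformly in `t`. Hence the second moment of their average tends to `0`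
(`integral_sum_translates_sq_le`), and boundedness upgrades this to `L^p`. What remains is
deterministic: `f t = ∫ F (t, ω) dP` is continuous, so unique ergodicity makes its Birkhoff averages
converge uniformly to `∫ f dμ`, which is the integral of `F` by Fubini. -/

/-! ### Estimates in `L^p` -/

/-- If a bounded function has small second moment, its `L^p` norm is small. -/
theorem exists_pos_forall_eLpNorm_le_of_integral_sq_le {Ω : Type*} [MeasurableSpace Ω]
    (P : Measure Ω) [IsProbabilityMeasure P] {p : ENNReal} (hp_one : 1 ≤ p) (hp_top : p ≠ ⊤)
    {B ε : ℝ} (hB : 0 < B) (hε : 0 < ε) :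
    ∃ η > 0, ∀ g : Ω → ℝ, Measurable g → (∀ ω, |g ω| ≤ B) → ∫ ω, g ω ^ 2 ∂P ≤ η →
      eLpNorm g p P ≤ ENNReal.ofReal ε := by
  have hp0 : p ≠ 0 := (zero_lt_one.trans_le hp_one).ne'
  set q := p.toReal with hq
  have hq1 : 1 ≤ q := by
    have := ENNReal.toReal_mono hp_top hp_one
    simpa using this
  have hq0 : 0 < q := zero_lt_one.trans_le hq1
  have hεq : 0 < ε ^ q := Real.rpow_pos_of_pos hε q
  have hBq : 0 < B ^ q := Real.rpow_pos_of_pos hB q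
  -- Chebyshev: split at `|g| = ε / 2`. The small values contribute at most `ε ^ q / 2` because `q ≥
  -- 1`; this `η` makes the large ones contribute no more.
  refine ⟨ε ^ q / 2 * ((ε / 2) ^ 2 / B ^ q), by positivity, fun g hg hgB hgη => ?_⟩
  have hmem : MemLp g p P :=
    MemLp.of_bound hg.aestronglyMeasurable B (ae_of_all _ fun ω => by simpa using hgB ω)
  have hmem2 : MemLp g 2 P :=
    MemLp.of_bound hg.aestronglyMeasurable B (ae_of_all _ fun ω => by simpa using hgB ω)
  rw [hmem.eLpNorm_eq_integral_rpow_norm hp0 hp_top]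
  refine ENNReal.ofReal_le_ofReal ?_
  rw [Real.rpow_inv_le_iff_of_pos (integral_nonneg fun ω => by positivity) hε.le hq0]
  have hpt : ∀ ω, ‖g ω‖ ^ q ≤ ε ^ q / 2 + B ^ q / (ε / 2) ^ 2 * g ω ^ 2 := by
    intro ω
    rw [Real.norm_eq_abs]
    rcases le_total |g ω| (ε / 2) with h | h
    · have h1 : |g ω| ^ q ≤ (ε / 2) ^ q := Real.rpow_le_rpow (abs_nonneg _) h hq0.le
      have h2 : (ε / 2) ^ q ≤ ε ^ q / 2 := by
        rw [Real.div_rpow hε.le zero_le_two]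
        refine div_le_div_of_nonneg_left hεq.le zero_lt_two ?_
        simpa using Real.rpow_le_rpow_of_exponent_le one_le_two hq1
      have : 0 ≤ B ^ q / (ε / 2) ^ 2 * g ω ^ 2 := by positivity
      linarith
    · have h1 : |g ω| ^ q ≤ B ^ q := Real.rpow_le_rpow (abs_nonneg _) (hgB ω) hq0.le
      have h2 : (ε / 2) ^ 2 ≤ g ω ^ 2 := by
        rw [← sq_abs (g ω)]
        gcongr
      have h3 : B ^ q ≤ B ^ q / (ε / 2) ^ 2 * g ω ^ 2 := by
        rw [div_mul_eq_mul_div, le_div_iff₀ (by positivity)]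
        gcongr
      linarith
  calc ∫ ω, ‖g ω‖ ^ q ∂P
      ≤ ∫ ω, (ε ^ q / 2 + B ^ q / (ε / 2) ^ 2 * g ω ^ 2) ∂P :=
        integral_mono (hmem.integrable_norm_rpow hp0 hp_top)
          ((integrable_const _).add (hmem2.integrable_sq.const_mul _)) hpt
    _ = ε ^ q / 2 + B ^ q / (ε / 2) ^ 2 * ∫ ω, g ω ^ 2 ∂P := by
        rw [integral_add (integrable_const _) (hmem2.integrable_sq.const_mul _),
          integral_const_mul]
        simp
    _ ≤ ε ^ q / 2 + B ^ q / (ε / 2) ^ 2 * (ε ^ q / 2 * ((ε / 2) ^ 2 / B ^ q)) := by gcongr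
    _ = ε ^ q := by field_simp; ring

/-- The `L^p` norm of an average is at most a common bound for the terms. -/
theorem eLpNorm_average_le {Ω : Type*} [MeasurableSpace Ω] {P : Measure Ω} {p : ENNReal}
    (hp_one : 1 ≤ p) {g : ℕ → Ω → ℝ} (hg : ∀ i, AEStronglyMeasurable (g i) P) {ε : ENNReal}
    (hgε : ∀ i, eLpNorm (g i) p P ≤ ε) (n : ℕ) :
    eLpNorm (fun ω => 1 / (n : ℝ) * ∑ i ∈ Finset.range n, g i ω) p P ≤ ε := by
  rcases n.eq_zero_or_pos with rfl | hn
  · simp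
  have h1 : (fun ω => 1 / (n : ℝ) * ∑ i ∈ Finset.range n, g i ω) =
      (1 / (n : ℝ)) • ∑ i ∈ Finset.range n, g i := by
    ext ω
    simp
  have hn' : (n : ENNReal) ≠ 0 := by exact_mod_cast hn.ne'
  rw [h1]
  calc eLpNorm ((1 / (n : ℝ)) • ∑ i ∈ Finset.range n, g i) p P
      = (n : ENNReal)⁻¹ * eLpNorm (∑ i ∈ Finset.range n, g i) p P := by
        rw [eLpNorm_const_smul, one_div, enorm_inv (by exact_mod_cast hn.ne')]
        congr 2
        simp
    _ ≤ (n : ENNReal)⁻¹ * ∑ i ∈ Finset.range n, eLpNorm (g i) p P := by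
        gcongr
        exact eLpNorm_sum_le (fun i _ => hg i) hp_one
    _ ≤ (n : ENNReal)⁻¹ * (n * ε) := by
        gcongr
        calc ∑ i ∈ Finset.range n, eLpNorm (g i) p P ≤ ∑ i ∈ Finset.range n, ε :=
              Finset.sum_le_sum fun i _ => hgε i
          _ = n * ε := by simp
    _ = ε := by
        rw [← mul_assoc, ENNReal.inv_mul_cancel hn' (ENNReal.natCast_ne_top n), one_mul]

/-! ### Uniquely ergodic maps -/

/-- **Uniform convergence of ergodic averages** of continuous functions for a uniquely ergodic
continuous map of a compact metric space. -/
theorem IsUniquelyErgodic.tendstoUniformly_birkhoffAverage {M : Type*} [MetricSpace M]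
    [CompactSpace M] [MeasurableSpace M] [BorelSpace M] {μ : Measure M} [IsProbabilityMeasure μ]
    {τ : M → M} (hτ : Continuous τ) (hμ : MeasurePreserving τ μ μ) (hue : IsUniquelyErgodic τ)
    {f : M → ℝ} (hf : Continuous f) :
    TendstoUniformly (fun n : ℕ => birkhoffAverage ℝ τ f n) (fun _ => ∫ x, f x ∂μ) atTop := by
  rw [Metric.tendstoUniformly_iff]
  by_contra! ⟨ε, hε, hfreq⟩
  obtain ⟨φ, hφ, hbad⟩ :=
    extraction_of_frequently_atTop (hfreq.and_eventually (eventually_gt_atTop 0))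
  choose hx hpos using hbad
  choose x hx using hx
  -- the empirical measures along the exceptional orbits
  let emp : ℕ → Measure M := fun k =>
    (φ k : ENNReal)⁻¹ • ∑ i ∈ Finset.range (φ k), Measure.dirac (τ^[i] (x k))
  have hemp : ∀ k, IsProbabilityMeasure (emp k) := by
    intro k
    refine ⟨?_⟩
    have h0 : (φ k : ENNReal) ≠ 0 := by exact_mod_cast (hpos k).ne'
    simp [emp, ENNReal.inv_mul_cancel h0]
  have hint : ∀ (g : M → ℝ), Continuous g → ∀ k,
      ∫ y, g y ∂(emp k) = birkhoffAverage ℝ τ g (φ k) (x k) := by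
    intro g hg k
    simp only [emp, integral_smul_measure, birkhoffAverage, birkhoffSum]
    rw [integral_finsetSum_measure fun i _ => integrable_dirac (by simp)]
    simp
  let E : ℕ → ProbabilityMeasure M := fun k => ⟨emp k, hemp k⟩
  -- Probability measures on a compact metric space are weakly compact. An ultrafilter finer than
  -- `atTop` turns the cluster point into a limit.
  obtain ⟨ν, -, hν⟩ := isCompact_univ.exists_mapClusterPt (f := atTop) (u := E) (by simp)
  obtain ⟨U, hU, hUν⟩ := mapClusterPt_iff_ultrafilter.1 hν
  rw [ProbabilityMeasure.tendsto_iff_forall_integral_tendsto] at hUν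
  have hlim : ∀ g : M → ℝ, Continuous g →
      Tendsto (fun k => birkhoffAverage ℝ τ g (φ k) (x k)) U (𝓝 (∫ y, g y ∂(ν : Measure M))) := by
    intro g hg
    have := hUν (BoundedContinuousFunction.mkOfCompact ⟨g, hg⟩)
    refine this.congr fun k => ?_
    exact hint g hg k
  have hinv : MeasurePreserving τ (ν : Measure M) ν := by
    refine ⟨hτ.measurable, ?_⟩
    have : IsProbabilityMeasure ((ν : Measure M).map τ) :=
      Measure.isProbabilityMeasure_map hτ.measurable.aemeasurable
    refine ext_of_forall_integral_eq_of_IsFiniteMeasure fun g => ?_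
    rw [integral_map hτ.measurable.aemeasurable g.continuous.aestronglyMeasurable]
    have h1 := hlim (fun y => g (τ y)) (g.continuous.comp hτ)
    have h2 := hlim g g.continuous
    -- Telescoping: composing with `τ` changes the orbit sum only by its two end terms.
    have h3 : Tendsto (fun k => birkhoffAverage ℝ τ (fun y => g (τ y)) (φ k) (x k)
        - birkhoffAverage ℝ τ g (φ k) (x k)) U (𝓝 0) := by
      have hφU : Tendsto (fun k => 2 * ‖g‖ / (φ k : ℝ)) U (𝓝 0) :=
        ((tendsto_natCast_atTop_atTop.comp hφ.tendsto_atTop).const_div_atTop (2 * ‖g‖)).mono_left hU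
      refine squeeze_zero_norm (fun k => ?_) hφU
      have h4 : birkhoffAverage ℝ τ (fun y => g (τ y)) (φ k) (x k) =
          birkhoffAverage ℝ τ g (φ k) (τ (x k)) := by
        simp only [birkhoffAverage, birkhoffSum, ← Function.iterate_succ_apply' τ,
          ← Function.iterate_succ_apply τ]
      rw [h4, birkhoffAverage_apply_sub_birkhoffAverage, norm_smul, norm_inv, Real.norm_natCast,
        inv_mul_eq_div]
      gcongr
      rw [two_mul]
      exact (norm_sub_le _ _).trans (add_le_add (g.norm_coe_le_norm _) (g.norm_coe_le_norm _))
    exact sub_eq_zero.1 (tendsto_nhds_unique (h1.sub h2) h3)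
  have hνμ : (ν : Measure M) = μ :=
    hue.unique ⟨inferInstance, hinv⟩ ⟨inferInstance, hμ⟩
  have hlimf := hlim f hf
  rw [hνμ] at hlimf
  obtain ⟨k, hk⟩ := ((Metric.tendsto_nhds.1 hlimf) ε hε).exists
  rw [dist_comm] at hk
  exact absurd hk (not_lt.2 (hx k))

/-! ### Mixing and second moments -/

/-- Strong mixing for simple functions. -/
theorem IsStronglyMixing.tendsto_integral_simpleFunc {Ω : Type*} [MeasurableSpace Ω] {d : ℕ}
    {θ : (Fin d → ℤ) → Ω → Ω} {P : Measure Ω} [IsProbabilityMeasure P]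
    (hθ : IsMeasurePreservingGroup θ P) (hP : IsStronglyMixing θ P) (f g : SimpleFunc Ω ℝ) :
    Tendsto (fun k => ∫ ω, f ω * g (θ k ω) ∂P) (comap (fun k : Fin d → ℤ => ‖k‖) atTop)
      (𝓝 ((∫ ω, f ω ∂P) * ∫ ω, g ω ∂P)) := by
  have hint : ∀ f g : SimpleFunc Ω ℝ, ∀ k, Integrable (fun ω => f ω * g (θ k ω)) P := by
    intro f g k
    exact (f * g.comp (θ k) (hθ.measurePreserving k).measurable).integrable_of_isFiniteMeasure
  -- Both sides are bilinear in `(f, g)`, so indicators suffice, and for these the claim is the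
  -- definition of mixing.
  induction f using SimpleFunc.induction with
  | @const a A hA =>
    induction g using SimpleFunc.induction with
    | @const b B hB =>
      have h := ((hP A B hA hB).const_mul (a * b))
      have e1 : ∀ k, ∫ ω, (SimpleFunc.piecewise A hA (SimpleFunc.const Ω a)
          (SimpleFunc.const Ω 0)) ω * (SimpleFunc.piecewise B hB (SimpleFunc.const Ω b)
          (SimpleFunc.const Ω 0)) (θ k ω) ∂P = a * b * P.real (A ∩ θ k ⁻¹' B) := by
        intro k
        have hm : MeasurableSet (A ∩ θ k ⁻¹' B) :=
          hA.inter ((hθ.measurePreserving k).measurable hB)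
        rw [mul_comm, ← smul_eq_mul, ← integral_indicator_const (a * b) hm]
        congr 1
        ext ω
        by_cases h1 : ω ∈ A <;> by_cases h2 : θ k ω ∈ B <;> simp [h1, h2]
      have e2 : ∀ (c : ℝ) (C : Set Ω) (hC : MeasurableSet C),
          ∫ ω, (SimpleFunc.piecewise C hC (SimpleFunc.const Ω c)
            (SimpleFunc.const Ω 0)) ω ∂P = c * P.real C := by
        intro c C hC
        rw [mul_comm, ← smul_eq_mul, ← integral_indicator_const c hC]
        congr 1
      simp only [e1, e2]
      convert! h using 2
      ring
    | @add g₁ g₂ _ h₁ h₂ =>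
      simp only [SimpleFunc.coe_add, Pi.add_apply, mul_add]
      rw [integral_add g₁.integrable_of_isFiniteMeasure g₂.integrable_of_isFiniteMeasure, mul_add]
      refine (h₁.add h₂).congr fun k => ?_
      rw [integral_add (hint _ _ k) (hint _ _ k)]
  | @add f₁ f₂ _ h₁ h₂ =>
    simp only [SimpleFunc.coe_add, Pi.add_apply, add_mul]
    rw [integral_add f₁.integrable_of_isFiniteMeasure f₂.integrable_of_isFiniteMeasure, add_mul]
    refine (h₁.add h₂).congr fun k => ?_
    rw [integral_add (hint _ _ k) (hint _ _ k)]

open Classical in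
/-- Second moment bound for sums of translates of functions with small correlations at distance
larger than `m`. -/
theorem integral_sum_translates_sq_le {Ω : Type*} [MeasurableSpace Ω] {d : ℕ}
    {θ : (Fin d → ℤ) → Ω → Ω} {P : Measure Ω} [IsProbabilityMeasure P]
    (hθ : IsMeasurePreservingGroup θ P) {h : ℕ → Ω → ℝ} (hh : ∀ i, Measurable (h i)) {B δ : ℝ}
    (hδ : 0 ≤ δ) (hB : ∀ i ω, |h i ω| ≤ B) {m : ℝ}
    (hcorr : ∀ i j (k : Fin d → ℤ), m < ‖k‖ → |∫ ω, h i ω * h j (θ k ω) ∂P| ≤ δ)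
    (k : ℕ → Fin d → ℤ) (n : ℕ) :
    ∫ ω, (∑ i ∈ Finset.range n, h i (θ (k i) ω)) ^ 2 ∂P ≤
      B ^ 2 * ((Finset.range n ×ˢ Finset.range n).filter
        fun q : ℕ × ℕ => ‖k q.1 - k q.2‖ ≤ m).card + (n : ℝ) ^ 2 * δ := by
  have hmeas : ∀ i l, Measurable fun ω => h i (θ l ω) := fun i l =>
    (hh i).comp (hθ.measurePreserving l).measurable
  have hbound : ∀ i j l l' ω, ‖h i (θ l ω) * h j (θ l' ω)‖ ≤ B ^ 2 := by
    intro i j l l' ω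
    rw [norm_mul, sq]
    exact mul_le_mul (hB _ _) (hB _ _) (norm_nonneg _) ((abs_nonneg _).trans (hB i (θ l ω)))
  have hint : ∀ i j l l', Integrable (fun ω => h i (θ l ω) * h j (θ l' ω)) P := fun i j l l' =>
    Integrable.of_bound ((hmeas i l).mul (hmeas j l')).aestronglyMeasurable (B ^ 2)
      (ae_of_all _ (hbound i j l l'))
  -- Invariance under `θ l` and the group law: a correlation depends only on the displacement `l' -
  -- l`.
  have hshift : ∀ i j l l', ∫ ω, h i (θ l ω) * h j (θ l' ω) ∂P =
      ∫ ω, h i ω * h j (θ (l' - l) ω) ∂P := by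
    intro i j l l'
    have hcomp : ∀ ω, θ (l' - l) (θ l ω) = θ l' ω := fun ω => by
      simpa using congrFun (hθ.comp (l' - l) l) ω
    have hmap := integral_map (μ := P) (hθ.measurePreserving l).measurable.aemeasurable
      (f := fun ω => h i ω * h j (θ (l' - l) ω))
      ((hh i).mul (hmeas j (l' - l))).aestronglyMeasurable
    rw [(hθ.measurePreserving l).map_eq] at hmap
    simp only [hmap, hcomp]
  have hterm : ∀ i j, ∫ ω, h i (θ (k i) ω) * h j (θ (k j) ω) ∂P ≤
      (if ‖k i - k j‖ ≤ m then B ^ 2 else 0) + δ := by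
    intro i j
    split_ifs with hij
    · have : ∫ ω, h i (θ (k i) ω) * h j (θ (k j) ω) ∂P ≤ ∫ ω, B ^ 2 ∂P :=
        integral_mono (hint _ _ _ _) (integrable_const _)
          fun ω => (le_abs_self _).trans (hbound i j (k i) (k j) ω)
      simp only [integral_const, probReal_univ, one_smul] at this
      linarith
    · rw [hshift, zero_add]
      refine (le_abs_self _).trans (hcorr _ _ _ ?_)
      rw [norm_sub_rev]
      exact not_le.1 hij
  calc ∫ ω, (∑ i ∈ Finset.range n, h i (θ (k i) ω)) ^ 2 ∂P
      = ∑ i ∈ Finset.range n, ∑ j ∈ Finset.range n,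
          ∫ ω, h i (θ (k i) ω) * h j (θ (k j) ω) ∂P := by
        simp only [sq, Finset.sum_mul_sum]
        rw [integral_finsetSum _ fun i _ => integrable_finsetSum _ fun j _ => hint _ _ _ _]
        exact Finset.sum_congr rfl fun i _ => integral_finsetSum _ fun j _ => hint _ _ _ _
    _ ≤ ∑ i ∈ Finset.range n, ∑ j ∈ Finset.range n,
          ((if ‖k i - k j‖ ≤ m then B ^ 2 else 0) + δ) :=
        Finset.sum_le_sum fun i _ => Finset.sum_le_sum fun j _ => hterm i j
    _ = _ := by
        rw [← Finset.sum_product', Finset.sum_add_distrib, ← Finset.sum_filter]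
        simp
        ring

open Classical in
/-- The number of close pairs with indices in `0, …, n - 1` is controlled by `closePairCount`. -/
theorem card_close_pairs_range_le {M : Type*} {d : ℕ} (τ : M → M) (κ : M → Fin d → ℤ)
    (m n : ℕ) (t : M) :
    (((Finset.range n ×ˢ Finset.range n).filter fun q : ℕ × ℕ =>
      ‖birkhoffSum τ κ q.1 t - birkhoffSum τ κ q.2 t‖ ≤ (m : ℝ)).card : ℝ) ≤
      closePairCount τ κ m n t + 2 * n := by
  -- The averages use indices from `0`, the hypothesis indices from `1`; pairs containing `0` cost
  -- at most `2 * n`, negligible against `n ^ 2`.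
  have hsub : ((Finset.range n ×ˢ Finset.range n).filter fun q : ℕ × ℕ =>
      ‖birkhoffSum τ κ q.1 t - birkhoffSum τ κ q.2 t‖ ≤ (m : ℝ)) ⊆
      ((Finset.Icc 1 n ×ˢ Finset.Icc 1 n).filter fun q : ℕ × ℕ =>
        ‖birkhoffSum τ κ q.1 t - birkhoffSum τ κ q.2 t‖ ≤ (m : ℝ)) ∪
      (({0} ×ˢ Finset.range n) ∪ (Finset.range n ×ˢ {0})) := by
    rintro ⟨i, j⟩ h
    simp only [Finset.mem_filter, Finset.mem_product, Finset.mem_range, Finset.mem_union,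
      Finset.mem_Icc, Finset.mem_singleton] at h ⊢
    obtain ⟨⟨hi, hj⟩, hm⟩ := h
    simp only [hm, and_true]
    omega
  have hcard := (Finset.card_le_card hsub).trans ((Finset.card_union_le _ _).trans
    (add_le_add_right (Finset.card_union_le _ _) _))
  simp only [Finset.card_product, Finset.card_singleton, Finset.card_range, one_mul,
    mul_one] at hcard
  have : (closePairCount τ κ m n t : ℕ) = ((Finset.Icc 1 n ×ˢ Finset.Icc 1 n).filter
      fun q : ℕ × ℕ => ‖birkhoffSum τ κ q.1 t - birkhoffSum τ κ q.2 t‖ ≤ (m : ℝ)).card := rfl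
  rw [← this] at hcard
  rw [two_mul]
  exact_mod_cast hcard

/-- Gives the boundedness without which the real supremum over `t` would not dominate the individual
counts. -/
theorem closePairCount_le_sq {M : Type*} {d : ℕ} (τ : M → M) (κ : M → Fin d → ℤ)
    (m n : ℕ) (t : M) : (closePairCount τ κ m n t : ℝ) ≤ (n : ℝ) ^ 2 := by
  have h : closePairCount τ κ m n t ≤ (Finset.Icc 1 n ×ˢ Finset.Icc 1 n).card :=
    Finset.card_filter_le _ _
  simp only [Finset.card_product, Nat.card_Icc, Nat.add_sub_cancel] at h
  rw [sq]
  exact_mod_cast h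

/-- Averages of finitely many simple functions, translated along the ergodic sums of `κ`, converge
to the averages of their means in `L^p`, uniformly in the starting point and in the order in which
the functions are used. -/
theorem IsStronglyMixing.eventually_eLpNorm_average_simpleFunc_le {M Ω : Type*}
    [MeasurableSpace Ω] {d : ℕ} {P : Measure Ω} [IsProbabilityMeasure P] {τ : M → M}
    {θ : (Fin d → ℤ) → Ω → Ω} (hθ : IsMeasurePreservingGroup θ P) (hP : IsStronglyMixing θ P)
    {κ : M → Fin d → ℤ} (hκ : PairCountCondition τ κ)
    {p : ENNReal} (hp_one : 1 ≤ p) (hp_top : p ≠ ⊤) (S : Finset (SimpleFunc Ω ℝ))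
    {ε : ℝ} (hε : 0 < ε) :
    ∀ᶠ n : ℕ in atTop, ∀ (t : M) (s : ℕ → SimpleFunc Ω ℝ), (∀ i, s i ∈ S) →
      eLpNorm (fun ω => 1 / (n : ℝ) * ∑ i ∈ Finset.range n,
        (s i (θ (birkhoffSum τ κ i t) ω) - ∫ ω, s i ω ∂P)) p P ≤ ENNReal.ofReal ε := by
  classical
  let c : SimpleFunc Ω ℝ → SimpleFunc Ω ℝ := fun s => s.map fun x => x - ∫ ω, s ω ∂P
  have hc : ∀ s ω, c s ω = s ω - ∫ ω, s ω ∂P := fun s ω => rfl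
  have hc0 : ∀ s, ∫ ω, c s ω ∂P = 0 := by
    intro s
    simp only [hc]
    rw [integral_sub s.integrable_of_isFiniteMeasure (integrable_const _)]
    simp
  choose C hC using fun s : SimpleFunc Ω ℝ => (c s).exists_forall_norm_le
  obtain ⟨C₀, hC₀⟩ := (S.image C).exists_le
  -- The `1` only ensures that `B` is positive.
  set B := max C₀ 1 with hBdef
  have hB0 : 0 < B := lt_max_of_lt_right one_pos
  have hB : ∀ s ∈ S, ∀ ω, |c s ω| ≤ B := fun s hs ω =>
    (hC s ω).trans ((hC₀ _ (Finset.mem_image_of_mem C hs)).trans (le_max_left _ _))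
  obtain ⟨η, hη, hηε⟩ :=
    exists_pos_forall_eLpNorm_le_of_integral_sq_le P hp_one hp_top hB0 hε
  have hmix : ∀ᶠ k in comap (fun k : Fin d → ℤ => ‖k‖) atTop, ∀ s ∈ S, ∀ s' ∈ S,
      |∫ ω, c s ω * c s' (θ k ω) ∂P| ≤ η / 2 := by
    rw [eventually_all_finset]
    intro s _
    rw [eventually_all_finset]
    intro s' _
    have h := hP.tendsto_integral_simpleFunc hθ (c s) (c s')
    rw [hc0, zero_mul] at h
    have h' := h.abs
    rw [abs_zero] at h'
    exact h'.eventually_le_const (by positivity)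
  rw [eventually_comap, eventually_atTop] at hmix
  obtain ⟨a, ha⟩ := hmix
  -- Finiteness of `S` gives one mixing radius `a` for all pairs; it is rounded up because the pair
  -- count condition concerns natural radii.
  set m := ⌈a⌉₊ with hm
  have hlim : Tendsto (fun n : ℕ => B ^ 2 *
      (1 / (n : ℝ) ^ 2 * (⨆ t : M, (closePairCount τ κ m n t : ℝ)) + 2 / (n : ℝ)))
      atTop (𝓝 0) := by
    have := ((hκ m).add (tendsto_const_div_atTop_nhds_zero_nat (2 : ℝ))).const_mul (B ^ 2)
    simpa using this
  filter_upwards [hlim.eventually_le_const (half_pos hη), eventually_gt_atTop 0] with n hn hn0 t s hs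
  have hn0' : (0 : ℝ) < n := by exact_mod_cast hn0
  simp only [← hc]
  have hmeas : ∀ i, Measurable fun ω => c (s i) (θ (birkhoffSum τ κ i t) ω) := fun i =>
    (c (s i)).measurable.comp (hθ.measurePreserving _).measurable
  refine hηε _ ((Finset.measurable_sum _ fun i _ => hmeas i).const_mul _) (fun ω => ?_) ?_
  · rw [abs_mul, abs_of_nonneg (by positivity), one_div, inv_mul_le_iff₀ hn0']
    refine (Finset.abs_sum_le_sum_abs _ _).trans
      ((Finset.sum_le_sum fun i _ => hB _ (hs i) _).trans ?_)
    simp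
  · have h2 := integral_sum_translates_sq_le hθ (h := fun i => c (s i))
      (fun i => (c (s i)).measurable) (half_pos hη).le (fun i => hB _ (hs i)) (m := m)
      (fun i j k hk => ha _ ((Nat.le_ceil a).trans hk.le) k rfl _ (hs i) _ (hs j))
      (fun i => birkhoffSum τ κ i t) n
    have h3 := card_close_pairs_range_le τ κ m n t
    have h4 : (closePairCount τ κ m n t : ℝ) ≤ ⨆ t : M, (closePairCount τ κ m n t : ℝ) :=
      le_ciSup (f := fun t : M => (closePairCount τ κ m n t : ℝ))
        ⟨(n : ℝ) ^ 2, by rintro _ ⟨t, rfl⟩; exact closePairCount_le_sq τ κ m n t⟩ t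
    simp only [mul_pow]
    rw [integral_const_mul]
    calc _ ≤ (1 / (n : ℝ)) ^ 2 * (B ^ 2 * ((⨆ t : M, (closePairCount τ κ m n t : ℝ)) + 2 * n) +
          (n : ℝ) ^ 2 * (η / 2)) := by
          refine mul_le_mul_of_nonneg_left (h2.trans ?_) (by positivity)
          gcongr
          linarith
      _ = B ^ 2 * (1 / (n : ℝ) ^ 2 * (⨆ t : M, (closePairCount τ κ m n t : ℝ)) + 2 / (n : ℝ))
          + η / 2 := by
          field_simp
      _ ≤ η := by linarith

/-! ### Approximation by finitely many simple functions -/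

/-- A family of functions depending continuously on a parameter and dominated by an `L^p` function
is continuous as a map into `L^p`. -/
theorem tendsto_eLpNorm_sub_of_continuous {M Ω : Type*} [TopologicalSpace M]
    [FirstCountableTopology M] [MeasurableSpace Ω] {P : Measure Ω} {p : ENNReal} (hp0 : p ≠ 0)
    (hp_top : p ≠ ⊤) {f : M → Ω → ℝ} (hf : ∀ t, Measurable (f t)) {G : Ω → ℝ}
    (hG : MemLp G p P) (hfG : ∀ᵐ ω ∂P, ∀ t, |f t ω| ≤ G ω)
    (hcont : ∀ᵐ ω ∂P, Continuous fun t => f t ω) (t : M) :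
    Tendsto (fun s => eLpNorm (fun ω => f s ω - f t ω) p P) (𝓝 t) (𝓝 0) := by
  have hq : 0 < p.toReal := ENNReal.toReal_pos hp0 hp_top
  simp only [eLpNorm_eq_lintegral_rpow_enorm_toReal hp0 hp_top]
  have hlim : Tendsto (fun s => ∫⁻ ω, ‖f s ω - f t ω‖ₑ ^ p.toReal ∂P) (𝓝 t) (𝓝 0) := by
    have h := tendsto_lintegral_filter_of_dominated_convergence (μ := P) (l := 𝓝 t)
      (F := fun s ω => ‖f s ω - f t ω‖ₑ ^ p.toReal) (f := fun _ => 0)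
      (fun ω => ‖(2 * G ω : ℝ)‖ₑ ^ p.toReal)
      (Eventually.of_forall fun s => ((hf s).sub (hf t)).enorm.pow_const _) ?_ ?_ ?_
    · simpa using h
    · refine Eventually.of_forall fun s => ?_
      filter_upwards [hfG] with ω hω
      gcongr
      rw [enorm_le_iff_norm_le, Real.norm_eq_abs, Real.norm_eq_abs]
      have h1 := hω s
      have h2 := hω t
      have h3 := abs_sub (f s ω) (f t ω)
      exact le_trans (by linarith) (le_abs_self _)
    · exact (lintegral_rpow_enorm_lt_top_of_eLpNorm_lt_top hp0 hp_top
        (hG.const_mul 2).eLpNorm_lt_top).ne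
    · filter_upwards [hcont] with ω hω
      have h1 : Tendsto (fun s => ‖f s ω - f t ω‖ₑ) (𝓝 t) (𝓝 0) := by
        have := (hω.tendsto t).sub_const (f t ω)
        rw [sub_self] at this
        simpa using this.enorm
      simpa [ENNReal.zero_rpow_of_pos hq] using h1.ennrpow_const p.toReal
  simpa [ENNReal.zero_rpow_of_pos (inv_pos.2 hq)] using hlim.ennrpow_const (1 / p.toReal)

/-- A family of functions depending continuously on a parameter in a compact space and dominated by
an `L^p` function is uniformly approximated by finitely many simple functions. -/
theorem exists_finset_simpleFunc_eLpNorm_sub_le {M Ω : Type*} [TopologicalSpace M]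
    [CompactSpace M] [FirstCountableTopology M] [MeasurableSpace Ω] {P : Measure Ω} {p : ENNReal}
    (hp_one : 1 ≤ p) (hp_top : p ≠ ⊤) {f : M → Ω → ℝ} (hfm : ∀ t, Measurable (f t))
    (hf : ∀ t, MemLp (f t) p P) {G : Ω → ℝ} (hG : MemLp G p P) (hfG : ∀ᵐ ω ∂P, ∀ t, |f t ω| ≤ G ω)
    (hcont : ∀ᵐ ω ∂P, Continuous fun t => f t ω) {ε : ℝ} (hε : 0 < ε) :
    ∃ (S : Finset (SimpleFunc Ω ℝ)) (s : M → SimpleFunc Ω ℝ), (∀ t, s t ∈ S) ∧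
      ∀ t, eLpNorm (fun ω => f t ω - s t ω) p P ≤ ENNReal.ofReal ε := by
  classical
  have hp0 : p ≠ 0 := (zero_lt_one.trans_le hp_one).ne'
  have hε2 : 0 < ENNReal.ofReal (ε / 2) := ENNReal.ofReal_pos.2 (half_pos hε)
  choose g hg _ using fun t => (hf t).exists_simpleFunc_eLpNorm_sub_lt hp_top hε2.ne'
  let U : M → Set M := fun t => {s | eLpNorm (fun ω => f s ω - f t ω) p P < ENNReal.ofReal (ε / 2)}
  have hU : ∀ t, U t ∈ 𝓝 t := fun t =>
    (tendsto_eLpNorm_sub_of_continuous hp0 hp_top hfm hG hfG hcont t).eventually_lt_const hε2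
  obtain ⟨T, hT⟩ := CompactSpace.elim_nhds_subcover U hU
  have hex : ∀ t, ∃ c ∈ T, t ∈ U c := fun t => by
    have : t ∈ ⋃ x ∈ T, U x := hT ▸ Set.mem_univ t
    simpa using this
  choose c hcT hcU using hex
  refine ⟨T.image g, fun t => g (c t), fun t => Finset.mem_image_of_mem g (hcT t), fun t => ?_⟩
  have heq : (fun ω => f t ω - g (c t) ω) =
      (fun ω => f t ω - f (c t) ω) + (f (c t) - ⇑(g (c t))) := by
    ext ω
    simp
  rw [heq]
  refine (eLpNorm_add_le ((hf t).1.sub (hf (c t)).1)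
    ((hf (c t)).1.sub (g (c t)).measurable.aestronglyMeasurable) hp_one).trans ?_
  refine (add_le_add (hcU t).le (hg (c t)).le).trans ?_
  rw [← ENNReal.ofReal_add (by positivity) (by positivity), add_halves]

/-- Transfers the `L^p` approximation of functions to their means. -/
theorem enorm_integral_le_eLpNorm {Ω : Type*} [MeasurableSpace Ω] {P : Measure Ω}
    [IsProbabilityMeasure P] {p : ENNReal} (hp_one : 1 ≤ p) {g : Ω → ℝ}
    (hg : AEStronglyMeasurable g P) : ‖∫ ω, g ω ∂P‖ₑ ≤ eLpNorm g p P := by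
  refine (enorm_integral_le_lintegral_enorm _).trans ?_
  rw [← eLpNorm_one_eq_lintegral_enorm]
  exact eLpNorm_le_eLpNorm_of_exponent_le hp_one hg

/-! ### The skew product averages -/

theorem theorem4p6 {M Ω : Type*} [MetricSpace M] [CompactSpace M] [MeasurableSpace M]
    [BorelSpace M] [MeasurableSpace Ω] {d : ℕ}
    (μ : Measure M) [IsProbabilityMeasure μ] (P : Measure Ω) [IsProbabilityMeasure P]
    (τ : M → M) (hτ_cont : Continuous τ) (hτ_inv : MeasurePreserving τ μ μ)
    (hτ_ue : IsUniquelyErgodic τ)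
    (θ : (Fin d → ℤ) → Ω → Ω) (hθ : IsMeasurePreservingGroup θ P) (hP : IsStronglyMixing θ P)
    (κ : M → Fin d → ℤ) (hκ_meas : Measurable κ) (hκ : PairCountCondition τ κ)
    (p : ENNReal) (hp_one : 1 ≤ p) (hp_top : p ≠ ⊤)
    (F : M × Ω → ℝ) (hF_meas : Measurable F)
    (hF_sup : MemLp (fun ω => ⨆ t : M, |F (t, ω)|) p P)
    (hF_cont : ∀ᵐ ω ∂P, Continuous fun t : M => F (t, ω)) :
    Integrable F (μ.prod P) ∧
      (∀ (n : ℕ) (t : M), MemLp (skewAverage τ κ θ F n t) p P) ∧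
      Tendsto
        (fun n : ℕ => ⨆ t : M,
          eLpNorm (fun ω => skewAverage τ κ θ F n t ω - ∫ z, F z ∂(μ.prod P)) p P)
        atTop (𝓝 0) := by
  set G : Ω → ℝ := fun ω => ⨆ t : M, |F (t, ω)| with hGdef
  have hFG : ∀ᵐ ω ∂P, ∀ t, |F (t, ω)| ≤ G ω := by
    filter_upwards [hF_cont] with ω hω t
    -- Continuity on a compact space bounds the family, so `G ω` is a true supremum here.
    exact le_ciSup (f := fun t => |F (t, ω)|) (isCompact_range hω.abs).bddAbove t
  have hFm : ∀ t, Measurable fun ω => F (t, ω) := fun t =>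
    hF_meas.comp measurable_prodMk_left
  have hFLp : ∀ t, MemLp (fun ω => F (t, ω)) p P := fun t =>
    hF_sup.mono' (hFm t).aestronglyMeasurable (hFG.mono fun ω hω => hω t)
  have hFθ : ∀ t k, MemLp (fun ω => F (t, θ k ω)) p P := fun t k =>
    (hFLp t).comp_measurePreserving (hθ.measurePreserving k)
  have hGint : Integrable G P := hF_sup.integrable hp_one
  have hFint : Integrable F (μ.prod P) :=
    (hGint.comp_snd μ).mono' hF_meas.aestronglyMeasurable
      (Measure.quasiMeasurePreserving_snd.ae hFG |>.mono fun z hz => hz z.1)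
  refine ⟨hFint, fun n t => (memLp_finsetSum _ fun i _ => hFθ _ _).const_mul _, ?_⟩
  set f : M → ℝ := fun t => ∫ ω, F (t, ω) ∂P with hfdef
  have hf : Continuous f :=
    continuous_of_dominated (fun t => (hFm t).aestronglyMeasurable)
      (fun t => hFG.mono fun ω hω => hω t) hGint hF_cont
  have hfint : ∫ z, F z ∂(μ.prod P) = ∫ t, f t ∂μ := integral_prod F hFint
  rw [hfint, ENNReal.tendsto_nhds_zero]
  intro ε hε
  -- `ε` may be `∞`, so a finite `r` below it is split among the four error terms.
  obtain ⟨r, hr0, hrε⟩ := ENNReal.lt_iff_exists_nnreal_btwn.1 hε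
  set e : ℝ := r / 4 with hedef
  have he : 0 < e := by
    have : (0 : ℝ) < r := by exact_mod_cast hr0
    positivity
  obtain ⟨S, s, hsS, hs⟩ := exists_finset_simpleFunc_eLpNorm_sub_le hp_one hp_top
    (f := fun t ω => F (t, ω)) hFm hFLp hF_sup hFG hF_cont he
  have herg := Metric.tendstoUniformly_iff.1
    (hτ_ue.tendstoUniformly_birkhoffAverage hτ_cont hτ_inv hf) e he
  filter_upwards [herg,
    hP.eventually_eLpNorm_average_simpleFunc_le hθ hκ hp_one hp_top S he] with n hn1 hn2
  refine iSup_le fun t => ?_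
  have hsm : ∀ i, AEStronglyMeasurable
      (fun ω => s (τ^[i] t) (θ (birkhoffSum τ κ i t) ω)) P := fun i =>
    ((s _).measurable.comp (hθ.measurePreserving _).measurable).aestronglyMeasurable
  have hm1 : ∀ i, AEStronglyMeasurable (fun ω => F (τ^[i] t, θ (birkhoffSum τ κ i t) ω) -
      s (τ^[i] t) (θ (birkhoffSum τ κ i t) ω)) P := fun i => (hFθ _ _).1.sub (hsm i)
  -- The errors: simple approximation, mixing, approximation of the means, and the ergodic average
  -- of `f`. The map `s` need not be measurable in `t`, since the bound for `g₂` holds for every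
  -- sequence drawn from `S`.
  set g₁ : Ω → ℝ := fun ω => 1 / (n : ℝ) * ∑ i ∈ Finset.range n,
    (F (τ^[i] t, θ (birkhoffSum τ κ i t) ω) - s (τ^[i] t) (θ (birkhoffSum τ κ i t) ω)) with hg₁
  set g₂ : Ω → ℝ := fun ω => 1 / (n : ℝ) * ∑ i ∈ Finset.range n,
    (s (τ^[i] t) (θ (birkhoffSum τ κ i t) ω) - ∫ ω, s (τ^[i] t) ω ∂P) with hg₂
  set g₃ : Ω → ℝ := fun _ => 1 / (n : ℝ) * ∑ i ∈ Finset.range n,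
    (∫ ω, s (τ^[i] t) ω ∂P - f (τ^[i] t)) with hg₃
  set g₄ : Ω → ℝ := fun _ => birkhoffAverage ℝ τ f n t - ∫ t, f t ∂μ with hg₄
  have hg₁m : AEStronglyMeasurable g₁ P :=
    (Finset.aestronglyMeasurable_fun_sum _ fun i _ => hm1 i).const_mul _
  have hg₂m : AEStronglyMeasurable g₂ P :=
    (Finset.aestronglyMeasurable_fun_sum _ fun i _ =>
      (hsm i).sub aestronglyMeasurable_const).const_mul _
  have hg₃m : AEStronglyMeasurable g₃ P := aestronglyMeasurable_const
  have hg₄m : AEStronglyMeasurable g₄ P := aestronglyMeasurable_const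
  have hdecomp : (fun ω => skewAverage τ κ θ F n t ω - ∫ t, f t ∂μ) = g₁ + g₂ + g₃ + g₄ := by
    ext ω
    simp only [skewAverage, hg₁, hg₂, hg₃, hg₄, Pi.add_apply, Finset.sum_sub_distrib,
      birkhoffAverage, birkhoffSum, smul_eq_mul]
    ring
  have hconst : ∀ a : ℝ, eLpNorm (fun _ : Ω => a) p P = ‖a‖ₑ := fun a => by
    simp [eLpNorm_const a (zero_lt_one.trans_le hp_one).ne' (IsProbabilityMeasure.ne_zero P)]
  have h1 : eLpNorm g₁ p P ≤ ENNReal.ofReal e := by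
    refine eLpNorm_average_le hp_one hm1 (fun i => ?_) n
    refine (eLpNorm_comp_measurePreserving (g := fun ω => F (τ^[i] t, ω) - s (τ^[i] t) ω)
      ((hFm _).sub (s _).measurable).aestronglyMeasurable
      (hθ.measurePreserving (birkhoffSum τ κ i t))).trans_le (hs _)
  have h3 : eLpNorm g₃ p P ≤ ENNReal.ofReal e := by
    refine eLpNorm_average_le hp_one (g := fun i _ => ∫ ω, s (τ^[i] t) ω ∂P - f (τ^[i] t))
      (fun i => aestronglyMeasurable_const) (fun i => ?_) n
    rw [hconst, ← enorm_neg, neg_sub, hfdef,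
      ← integral_sub ((hFLp _).integrable hp_one) (s _).integrable_of_isFiniteMeasure]
    exact (enorm_integral_le_eLpNorm hp_one
      ((hFm _).sub (s _).measurable).aestronglyMeasurable).trans (hs _)
  have h4 : eLpNorm g₄ p P ≤ ENNReal.ofReal e := by
    have := (hn1 t).le
    rw [dist_comm, Real.dist_eq] at this
    rw [hconst, Real.enorm_eq_ofReal_abs]
    exact ENNReal.ofReal_le_ofReal this
  rw [hdecomp]
  calc eLpNorm (g₁ + g₂ + g₃ + g₄) p P
      ≤ eLpNorm g₁ p P + eLpNorm g₂ p P + eLpNorm g₃ p P + eLpNorm g₄ p P := by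
        refine (eLpNorm_add_le ((hg₁m.add hg₂m).add hg₃m) hg₄m hp_one).trans ?_
        gcongr
        refine (eLpNorm_add_le (hg₁m.add hg₂m) hg₃m hp_one).trans ?_
        gcongr
        exact eLpNorm_add_le hg₁m hg₂m hp_one
    _ ≤ ENNReal.ofReal e + ENNReal.ofReal e + ENNReal.ofReal e + ENNReal.ofReal e := by
        gcongr
        exact hn2 t _ fun i => hsS _
    _ = ENNReal.ofReal r := by
        rw [← ENNReal.ofReal_add he.le he.le, ← ENNReal.ofReal_add (by positivity) he.le,
          ← ENNReal.ofReal_add (by positivity) he.le]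
        congr 1
        ring
    _ ≤ ε := by
        rw [ENNReal.ofReal_coe_nnreal]
        exact hrε.le
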